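/- Write $X\subseteq^* Y$ if $X\setminus Y$ is finite. A set $C\subseteq\mathbb{N}$ is *cohesive* if it is infinite and for every computably enumerable (c.e.) set $W$ either $C\subseteq^* W$ or $C\subseteq^*\mathbb{N}\setminus W$; it is *co-c.e.* if $\mathbb{N}\setminus C$ is c.e. A *computable linear order* $\mathcal{L}=(L,\prec_{\mathcal L})$ consists of a non-empty computable set $L\subseteq\mathbb{N}$ and a computable relation $\prec_{\mathcal L}$ that is a strict linear order of $L$; it is a *computable copy of $\omega$* if it is isomorphic (not necessarily computably) to $(\mathbb{N},<)$. For a computable linear order $\mathcal{L}$ and a cohesive set $C$, the *cohesive power* $\Pi_C\mathcal{L}$ is the following linear order. Let $D$ be the set of partial computable functions $\varphi\colon\mathbb{N}\to L$ with $C\subseteq^*\operatorname{dom}(\varphi)$. For $\varphi,\psi\in D$ let $\varphi=_C\psi$ mean $C\subseteq^*\{n:\varphi(n){\downarrow}=\psi(n){\downarrow}\}$. The elements of $\Pi_C\mathcal{L}$ are the $=_C$-classes $[\varphi]$ with $\varphi\in D$, and $[\varphi]\prec[\psi]$ if and only if $C\subseteq^*\{n:\varphi(n){\downarrow},\ \psi(n){\downarrow},\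 \varphi(n)\prec_{\mathcal L}\psi(n)\}$. For a linear order $\mathcal{M}=(M,\prec)$ and $x\in M$, let $\mathbf{c}_F(x)$ be the set of $y\in M$ for which the closed interval of $\mathcal{M}$ with endpoints $x$ and $y$ is finite. The sets $\mathbf{c}_F(x)$ partition $M$ into non-empty intervals. The *finite condensation* $\mathbf{c}_F(\mathcal{M})$ is the set of these intervals, ordered by $I\prec J$ if and only if $a\prec b$ for all $a\in I$ and $b\in J$. **Theorem.** Let $\mathcal{L}$ be a computable copy of $\omega$, and let $C$ be co-c.e. and cohesive. Then $\mathbf{c}_F(\Pi_C\mathcal{L})$ has order-type $\mathbf{1}+\eta$, that is, it is isomorphic to the linear order consisting of a single element followed by a copy of $(\mathbb{Q},<)$. -/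

import Mathlib

/-- A set of natural numbers is computably enumerable. -/
def IsCE (W : Set ℕ) : Prop := REPred fun n => n ∈ W

/-- A set of natural numbers is co-c.e. if its complement is computably enumerable. -/
def IsCoCE (C : Set ℕ) : Prop := IsCE Cᶜ

/-- Inclusion up to a finite set: all but finitely many elements of `X` lie in `Y`. -/
def AlmostSubset (X Y : Set ℕ) : Prop := (X \ Y).Finite

theorem AlmostSubset.mono {X Y Z : Set ℕ} (h : AlmostSubset X Y) (hYZ : Y ⊆ Z) :
    AlmostSubset X Z :=
  h.subset (Set.sdiff_subset_sdiff_right hYZ)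

theorem AlmostSubset.inter {X Y Z : Set ℕ} (hY : AlmostSubset X Y) (hZ : AlmostSubset X Z) :
    AlmostSubset X (Y ∩ Z) := by
  unfold AlmostSubset at *
  rw [Set.sdiff_inter]
  exact hY.union hZ

/-- A set `C` of natural numbers is cohesive if it is infinite and, for every c.e. set `W`,
it is almost contained in `W` or in the complement of `W`. -/
structure IsCohesive (C : Set ℕ) : Prop where
  infinite : C.Infinite
  split : ∀ W : Set ℕ, IsCE W → AlmostSubset C W ∨ AlmostSubset C Wᶜ

theorem IsCohesive.not_almostSubset_empty {C : Set ℕ} (hC : IsCohesive C) :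
    ¬ AlmostSubset C ∅ := by
  intro h
  unfold AlmostSubset at h
  rw [Set.sdiff_empty] at h
  exact hC.infinite h

/-- A computable linear order: a computable non-empty domain `carrier ⊆ ℕ` together with a
computable strict linear order `Rel ⊆ carrier × carrier` of it. -/
structure ComputableLinearOrder where
  carrier : Set ℕ
  Rel : ℕ → ℕ → Prop
  nonempty : carrier.Nonempty
  computable_carrier : ComputablePred fun n => n ∈ carrier
  computable_rel : ComputablePred fun p : ℕ × ℕ => Rel p.1 p.2
  mem_of_rel : ∀ a b, Rel a b → a ∈ carrier ∧ b ∈ carrier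
  irrefl : ∀ a, ¬ Rel a a
  trans : ∀ a b c, Rel a b → Rel b c → Rel a c
  total : ∀ a ∈ carrier, ∀ b ∈ carrier, Rel a b ∨ a = b ∨ Rel b a

namespace ComputableLinearOrder

/-- The domain of a computable linear order, as a type of its own: it is ordered by `L.Rel`,
not by the order of the natural numbers. -/
def Elem (L : ComputableLinearOrder) : Type := {n : ℕ // n ∈ L.carrier}

/-- The strict order of `L` on its domain. -/
def Elem.Lt {L : ComputableLinearOrder} (a b : L.Elem) : Prop := L.Rel a.1 b.1

instance (L : ComputableLinearOrder) : IsStrictTotalOrder L.Elem Elem.Lt where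
  irrefl a := L.irrefl a.1
  trans a b c := L.trans a.1 b.1 c.1
  trichotomous a b hab hba :=
    ((L.total a.1 a.2 b.1 b.2).resolve_left hab).elim Subtype.ext fun h => (hba h).elim

open Classical in
noncomputable instance (L : ComputableLinearOrder) : LinearOrder L.Elem :=
  linearOrderOfSTO Elem.Lt

/-- `L` is a computable copy of `ω`. -/
def IsCopyOfOmega (L : ComputableLinearOrder) : Prop :=
  OrderType.type L.Elem = OrderType.omega0

end ComputableLinearOrder

/-- The partial computable functions from `ℕ` to the domain of `L` that are defined on almost
all of `C`. -/
structure CohesiveRep (L : ComputableLinearOrder) (C : Set ℕ) where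
  fn : ℕ →. ℕ
  partrec : Partrec fn
  mem_carrier : ∀ n, ∀ a ∈ fn n, a ∈ L.carrier
  almost_dom : AlmostSubset C fn.Dom

namespace CohesiveRep

variable {L : ComputableLinearOrder} {C : Set ℕ}

/-- `φ =_C ψ`: for almost all `n ∈ C`, both are defined at `n`, with the same value. -/
def EqC (φ ψ : CohesiveRep L C) : Prop :=
  AlmostSubset C {n | ∃ a, a ∈ φ.fn n ∧ a ∈ ψ.fn n}

/-- For almost all `n ∈ C`, both functions are defined at `n`, and `φ(n)` is below `ψ(n)`
in `L`. -/
def LtC (φ ψ : CohesiveRep L C) : Prop :=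
  AlmostSubset C {n | ∃ a ∈ φ.fn n, ∃ b ∈ ψ.fn n, L.Rel a b}

theorem eqC_equivalence : Equivalence (EqC (L := L) (C := C)) where
  refl φ := φ.almost_dom.mono fun n hn => by
    obtain ⟨a, ha⟩ := Part.dom_iff_mem.1 hn
    exact ⟨a, ha, ha⟩
  symm h := AlmostSubset.mono h fun n ⟨a, h₁, h₂⟩ => ⟨a, h₂, h₁⟩
  trans h h' := (AlmostSubset.inter h h').mono fun n ⟨⟨a, h₁, h₂⟩, ⟨b, h₃, h₄⟩⟩ =>
    ⟨a, h₁, Part.mem_unique h₃ h₂ ▸ h₄⟩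

instance setoid (L : ComputableLinearOrder) (C : Set ℕ) : Setoid (CohesiveRep L C) :=
  ⟨EqC, eqC_equivalence⟩

theorem LtC.congr {φ φ' ψ ψ' : CohesiveRep L C} (hφ : EqC φ φ') (hψ : EqC ψ ψ')
    (h : LtC φ ψ) : LtC φ' ψ' :=
  ((AlmostSubset.inter hφ hψ).inter h).mono
    fun n ⟨⟨⟨a, h₁, h₂⟩, ⟨b, h₃, h₄⟩⟩, ⟨a', h₅, b', h₆, hr⟩⟩ => by
      obtain rfl := Part.mem_unique h₁ h₅
      obtain rfl := Part.mem_unique h₃ h₆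
      exact ⟨a, h₂, b, h₄, hr⟩

theorem isCE_lt (φ ψ : CohesiveRep L C) :
    IsCE {n | ∃ a ∈ φ.fn n, ∃ b ∈ ψ.fn n, L.Rel a b} := by
  have hg : Partrec fun p : ℕ × ℕ => Part.assert (L.Rel p.1 p.2) fun _ => Part.some () :=
    L.computable_rel.to_re
  have h₁ : Partrec₂ fun (n a : ℕ) => (ψ.fn n).bind fun b =>
      Part.assert (L.Rel a b) fun _ => Part.some () := by
    refine Partrec.bind (ψ.partrec.comp Computable.fst) ?_
    exact hg.comp ((Computable.snd.comp Computable.fst).pair Computable.snd)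
  refine (Partrec.dom_re (φ.partrec.bind h₁)).of_eq fun n => ?_
  simp [Part.dom_iff_mem, Part.mem_assert_iff]

theorem ltC_trichotomy (hC : IsCohesive C) (φ ψ : CohesiveRep L C) :
    LtC φ ψ ∨ EqC φ ψ ∨ LtC ψ φ := by
  rcases hC.split _ (isCE_lt φ ψ) with h | h
  · exact Or.inl h
  rcases hC.split _ (isCE_lt ψ φ) with h' | h'
  · exact Or.inr (Or.inr h')
  refine Or.inr (Or.inl (((h.inter h').inter (φ.almost_dom.inter ψ.almost_dom)).mono ?_))
  rintro n ⟨⟨h₁, h₂⟩, h₃, h₄⟩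
  obtain ⟨a, ha⟩ := Part.dom_iff_mem.1 h₃
  obtain ⟨b, hb⟩ := Part.dom_iff_mem.1 h₄
  rcases L.total a (φ.mem_carrier n a ha) b (ψ.mem_carrier n b hb) with hr | rfl | hr
  · exact (h₁ ⟨a, ha, b, hb, hr⟩).elim
  · exact ⟨a, ha, hb⟩
  · exact (h₂ ⟨b, hb, a, ha, hr⟩).elim

end CohesiveRep

/-- The domain of the cohesive power of the computable linear order `L` over the cohesive
set `C`. -/
def CohesivePower (L : ComputableLinearOrder) {C : Set ℕ} (_hC : IsCohesive C) : Type :=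
  Quotient (CohesiveRep.setoid L C)

namespace CohesivePower

variable {L : ComputableLinearOrder} {C : Set ℕ} {hC : IsCohesive C}

/-- The order relation of the cohesive power. -/
def Lt : CohesivePower L hC → CohesivePower L hC → Prop :=
  Quotient.lift₂ CohesiveRep.LtC fun _ _ _ _ hφ hψ => propext
    ⟨fun h => h.congr hφ hψ, fun h => h.congr (Setoid.symm hφ) (Setoid.symm hψ)⟩

instance : IsStrictTotalOrder (CohesivePower L hC) Lt where
  irrefl x := by
    induction x using Quotient.inductionOn with | h φ => ?_
    intro h
    refine hC.not_almostSubset_empty (AlmostSubset.mono (Y := _) h ?_)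
    rintro n ⟨a, ha, b, hb, hr⟩
    obtain rfl := Part.mem_unique ha hb
    exact L.irrefl a hr
  trans x y z := by
    induction x using Quotient.inductionOn with | h φ => ?_
    induction y using Quotient.inductionOn with | h ψ => ?_
    induction z using Quotient.inductionOn with | h θ => ?_
    intro h h'
    refine AlmostSubset.mono (AlmostSubset.inter h h') ?_
    rintro n ⟨⟨a, ha, b, hb, hr⟩, b', hb', c, hc, hr'⟩
    obtain rfl := Part.mem_unique hb hb'
    exact ⟨a, ha, c, hc, L.trans a b c hr hr'⟩
  trichotomous x y := by
    induction x using Quotient.inductionOn with | h φ => ?_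
    induction y using Quotient.inductionOn with | h ψ => ?_
    intro h h'
    exact Quotient.sound
      (((CohesiveRep.ltC_trichotomy hC φ ψ).resolve_left h).resolve_right h')

open Classical in
noncomputable instance : LinearOrder (CohesivePower L hC) := linearOrderOfSTO Lt

end CohesivePower

section FiniteCondensation

variable {α : Type*} [LinearOrder α]

/-- The block of `x`: the set of all `y` such that the closed interval between `x` and `y` is
finite. -/
def finiteBlock (x : α) : Set α := {y | (Set.Icc (min x y) (max x y)).Finite}

theorem finiteBlock_equivalence : Equivalence fun x y : α => y ∈ finiteBlock x where
  refl x := by simp [finiteBlock]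
  symm {x y} h := by simpa [finiteBlock, min_comm, max_comm] using h
  trans {x y z} h h' := (Set.Finite.union h h').subset
    (Set.uIcc_subset_uIcc_union_uIcc (a := x) (b := y) (c := z))

variable (α) in
/-- The equivalence relation whose classes are the blocks of `α`. -/
def finiteBlockSetoid : Setoid α := ⟨fun x y => y ∈ finiteBlock x, finiteBlock_equivalence⟩

variable (α) in
/-- The finite condensation of a linear order: the set of its blocks. -/
def FiniteCondensation : Type _ := Quotient (finiteBlockSetoid α)

/-- The block of `x` as an element of the finite condensation. -/
def FiniteCondensation.mk (x : α) : FiniteCondensation α := Quotient.mk (finiteBlockSetoid α) x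

/-- A block is below another one if all its elements are below all elements of the other. -/
def FiniteCondensation.Lt (I J : FiniteCondensation α) : Prop :=
  ∀ a b : α, FiniteCondensation.mk a = I → FiniteCondensation.mk b = J → a < b

theorem FiniteCondensation.mk_eq_mk {x y : α} :
    FiniteCondensation.mk x = FiniteCondensation.mk y ↔ y ∈ finiteBlock x :=
  Quotient.eq (r := finiteBlockSetoid α)

theorem FiniteCondensation.lt_of_lt {x y : α} (hxy : x < y) (h : y ∉ finiteBlock x) :
    FiniteCondensation.Lt (FiniteCondensation.mk x) (FiniteCondensation.mk y) := by
  intro a b ha hb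
  by_contra! hba
  rw [FiniteCondensation.mk_eq_mk] at ha hb
  apply h
  rcases le_total y a with hya | hya
  · refine Set.Finite.subset (finiteBlock_equivalence.symm ha) ?_
    rw [min_eq_left hxy.le, max_eq_right hxy.le]
    exact Set.Icc_subset_Icc (min_le_left _ _) (hya.trans (le_max_right _ _))
  · have hay : y ∈ finiteBlock a := by
      refine Set.Finite.subset hb ?_
      rw [min_eq_left hya, max_eq_right hya]
      exact Set.Icc_subset_Icc ((min_le_left _ _).trans hba) (le_max_right _ _)
    exact finiteBlock_equivalence.trans (finiteBlock_equivalence.symm ha) hay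

instance : IsStrictTotalOrder (FiniteCondensation α) FiniteCondensation.Lt where
  irrefl I := by
    induction I using Quotient.inductionOn with | h x => ?_
    exact fun h => lt_irrefl x (h x x rfl rfl)
  trans I J K hIJ hJK a c ha hc := by
    induction J using Quotient.inductionOn with | h y => ?_
    exact (hIJ a y ha rfl).trans (hJK y c rfl hc)
  trichotomous I J := by
    induction I using Quotient.inductionOn with | h x => ?_
    induction J using Quotient.inductionOn with | h y => ?_
    intro h h'
    by_contra hne
    have hn : y ∉ finiteBlock x := fun hy => hne (FiniteCondensation.mk_eq_mk.2 hy)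
    rcases lt_trichotomy x y with hxy | rfl | hxy
    · exact h (FiniteCondensation.lt_of_lt hxy hn)
    · exact hne rfl
    · exact h' (FiniteCondensation.lt_of_lt hxy fun hx => hn (finiteBlock_equivalence.symm hx))

open Classical in
noncomputable instance : LinearOrder (FiniteCondensation α) :=
  linearOrderOfSTO FiniteCondensation.Lt

end FiniteCondensation

/-! Distance in the power is read off pointwise. The interval between `[φ]` and `[ψ]`, with `[φ] ≺
[ψ]`, is infinite exactly when, for every `k`, at least `k` elements of `L` lie between `φ(n)` and
`ψ(n)` for almost all `n ∈ C` (`CohesivePower.infinite_Icc_iff`). So two blocks can be separated by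
a third once a single partial computable `θ` is far from both `φ` and `ψ` for every `k`
simultaneously. For fixed `k` a median works; the difficulty is to let `k` grow with `n`
effectively.

`IsCohesive.exists_uniform_choice` does this. A search at `n` proposes a parameter `k` with a
witness, and `k` is refused if some smaller number, not yet seen to leave `C`, already has a witness
for it. Since `C` is co-c.e., each `k` is eventually refused for good, so the parameters tend to
infinity along `C`; since `C` is cohesive, infinitely many successful searches on `C` mean almost
all succeed.

This gives density, and, since every element of a copy of `ω` has infinitely many elements above it,
also the absence of a last block. The constant function at the least element of `L` gives a first
block, and Cantor's theorem finishes. -/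

/-! ### Computable stages and almost inclusion -/

/-- Kleene normal form: a c.e. predicate has primitive recursive, increasing approximations. -/
theorem REPred.exists_primrec_stages {α : Type*} [Primcodable α] {p : α → Prop} (hp : REPred p) :
    ∃ R : α → ℕ → Prop, PrimrecRel R ∧ (∀ a s t, s ≤ t → R a s → R a t) ∧
      ∀ a, p a ↔ ∃ s, R a s := by
  obtain ⟨c, hc⟩ := Nat.Partrec.Code.exists_code.1 hp
  refine ⟨fun a s => ((Nat.Partrec.Code.evaln s c (Encodable.encode a)).isSome = true), ?_, ?_, ?_⟩
  · refine Primrec.eq.comp (Primrec.option_isSome.comp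
      (Nat.Partrec.Code.primrec_evaln.comp ((Primrec.snd.pair (Primrec.const c)).pair
        (Primrec.encode.comp Primrec.fst)))) (Primrec.const true)
  · intro a s t hst h
    obtain ⟨x, hx⟩ := Option.isSome_iff_exists.1 h
    exact Option.isSome_iff_exists.2 ⟨x, Nat.Partrec.Code.evaln_mono hst hx⟩
  · intro a
    have h : (Nat.Partrec.Code.eval c (Encodable.encode a)).Dom ↔ p a := by
      rw [hc]; simp [Part.dom_iff_mem]
    rw [← h, Part.dom_iff_mem]
    simp only [Nat.Partrec.Code.evaln_complete, Option.isSome_iff_exists]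
    exact exists_comm

theorem PrimrecRel.forall_mem_range {β : Type*} [Primcodable β] {R : ℕ → β → Prop}
    (hR : PrimrecRel R) : PrimrecRel fun (n : ℕ) (y : β) => ∀ x < n, R x y :=
  (hR.forall_mem_list.comp (Primrec.list_range.comp Primrec.fst) Primrec.snd).of_eq
    fun _ => by simp

theorem AlmostSubset.exists_bound {X Y : Set ℕ} (h : AlmostSubset X Y) :
    ∃ N, ∀ n ∈ X, N ≤ n → n ∈ Y := by
  obtain ⟨N, hN⟩ := h.bddAbove
  refine ⟨N + 1, fun n hn hNn => ?_⟩
  by_contra hY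
  have := hN ⟨hn, hY⟩
  omega

theorem AlmostSubset.of_bound {X Y : Set ℕ} (N : ℕ) (h : ∀ n ∈ X, N ≤ n → n ∈ Y) :
    AlmostSubset X Y := by
  refine (Set.finite_lt_nat N).subset ?_
  rintro n ⟨hn, hY⟩
  by_contra hN
  exact hY (h n hn (not_lt.1 hN))

theorem IsCohesive.exists_mem_ge {C Y : Set ℕ} (hC : IsCohesive C) (h : AlmostSubset C Y) (N : ℕ) :
    ∃ n ∈ C, N ≤ n ∧ n ∈ Y := by
  obtain ⟨M, hM⟩ := h.exists_bound
  obtain ⟨n, hn, hn'⟩ := hC.infinite.exists_gt (max M N)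
  exact ⟨n, hn, by omega, hM n hn (by omega)⟩

theorem IsCohesive.almostSubset_of_unbounded {C W : Set ℕ} (hC : IsCohesive C) (hW : IsCE W)
    (h : ∀ N, ∃ n ∈ C, N ≤ n ∧ n ∈ W) : AlmostSubset C W := by
  refine (hC.split W hW).resolve_right fun h' => ?_
  obtain ⟨N, hN⟩ := h'.exists_bound
  obtain ⟨n, hn, hNn, hnW⟩ := h N
  exact hN n hn hNn hnW

/-! ### Uniformization over a co-c.e. cohesive set -/

/-- Uniformization over a co-c.e. cohesive set: if, for every `k`, the c.e. condition `V n k x` can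
be met for almost all `n ∈ C`, then a single partial computable choice of `x` meets all these
conditions almost everywhere on `C`. -/
theorem IsCohesive.exists_uniform_choice {C : Set ℕ} (hC : IsCohesive C) (hco : IsCoCE C)
    {V : ℕ → ℕ → ℕ → Prop} (hV : REPred fun p : ℕ × ℕ × ℕ => V p.1 p.2.1 p.2.2)
    (hle : ∀ n k x, V n k x → k ≤ n) (hanti : ∀ n k l x, k ≤ l → V n l x → V n k x)
    (hex : ∀ k, AlmostSubset C {n | ∃ x, V n k x}) :
    ∃ θ : ℕ →. ℕ, Partrec θ ∧ (∀ n, ∀ x ∈ θ n, V n 0 x) ∧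
      ∀ k, AlmostSubset C {n | ∃ x ∈ θ n, V n k x} := by
  classical
  obtain ⟨R, hR, hRmono, hRV⟩ := hV.exists_primrec_stages
  obtain ⟨M, hM, hMmono, hMC⟩ := REPred.exists_primrec_stages hco
  -- The triple is (stage, parameter, value). A parameter is barred for `n` when some `m < n`, not
  -- yet enumerated outside `C`, shows a witness for it by that stage. Requiring the stage to be at
  -- least `n` forces late `n` to see old witnesses.
  let cond : ℕ → ℕ × ℕ × ℕ → Prop := fun n t => (n ≤ t.1 ∧ R (n, t.2.1, t.2.2) t.1) ∧
    ∀ m < n, M m t.1 ∨ ∀ x < t.1, ¬ R (m, t.2.1, x) t.1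
  have hcond : PrimrecRel cond := by
    have h₁ : PrimrecRel fun (x : ℕ) (q : ℕ × ℕ × ℕ) => ¬ R (q.1, q.2.2, x) q.2.1 := by
      refine (hR.comp (f := fun z : ℕ × ℕ × ℕ × ℕ => (z.2.1, z.2.2.2, z.1))
        (g := fun z : ℕ × ℕ × ℕ × ℕ => z.2.2.1) ?_ ?_).not
      · exact (Primrec.fst.comp .snd).pair
          ((Primrec.snd.comp (Primrec.snd.comp .snd)).pair .fst)
      · exact Primrec.fst.comp (Primrec.snd.comp .snd)
    have h₂ : PrimrecRel fun (m : ℕ) (t : ℕ × ℕ × ℕ) =>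
        M m t.1 ∨ ∀ x < t.1, ¬ R (m, t.2.1, x) t.1 := by
      refine PrimrecPred.or (hM.comp Primrec.fst (Primrec.fst.comp .snd)) ?_
      exact (PrimrecRel.forall_mem_range h₁).comp (f := fun z : ℕ × ℕ × ℕ × ℕ => z.2.1)
        (g := fun z : ℕ × ℕ × ℕ × ℕ => (z.1, z.2.1, z.2.2.1)) (Primrec.fst.comp .snd)
        (Primrec.fst.pair ((Primrec.fst.comp .snd).pair (Primrec.fst.comp (Primrec.snd.comp .snd))))
    refine PrimrecPred.and (PrimrecPred.and (Primrec.nat_le.comp .fst (Primrec.fst.comp .snd)) ?_)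
      ((PrimrecRel.forall_mem_range h₂).comp .fst .snd)
    exact hR.comp (f := fun z : ℕ × ℕ × ℕ × ℕ => (z.1, z.2.2.1, z.2.2.2))
      (Primrec.fst.pair ((Primrec.fst.comp (Primrec.snd.comp .snd)).pair
        (Primrec.snd.comp (Primrec.snd.comp .snd)))) (Primrec.fst.comp .snd)
  let e : ℕ → ℕ × ℕ × ℕ := Denumerable.ofNat (ℕ × ℕ × ℕ)
  have he : Primrec e := Primrec.ofNat _
  let search : ℕ →. ℕ := fun n => Nat.rfind fun t => Part.some (decide (cond n (e t)))
  have hsearch : Partrec search := by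
    refine Partrec.rfind (p := fun n t => Part.some (decide (cond n (e t)))) ?_
    exact ((hcond.comp Primrec.fst (he.comp .snd)).decide.to_comp).partrec
  let θ : ℕ →. ℕ := fun n => (search n).map fun t => (e t).2.2
  have hθ : Partrec θ :=
    hsearch.map ((Primrec.snd.comp (Primrec.snd.comp (he.comp .snd))).to_comp)
  have hθcond : ∀ n, ∀ x ∈ θ n, ∃ s k, cond n (s, k, x) := by
    intro n x hx
    obtain ⟨t, ht, rfl⟩ := (Part.mem_map_iff _).1 hx
    have := Nat.rfind_spec ht
    refine ⟨(e t).1, (e t).2.1, ?_⟩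
    simpa using this
  have hdom : ∀ n s k x, cond n (s, k, x) → n ∈ θ.Dom := by
    intro n s k x h
    have h' : (search n).Dom := by
      refine Nat.rfind_dom'.2 ⟨Encodable.encode (s, k, x), ?_, fun _ => trivial⟩
      simpa [e] using h
    exact h'
  have hRV' : ∀ n k x s, R (n, k, x) s → V n k x := fun n k x s h => (hRV (n, k, x)).2 ⟨s, h⟩
  have hadom : AlmostSubset C θ.Dom := by
    refine hC.almostSubset_of_unbounded (Partrec.dom_re hθ) fun N => ?_
    -- The least element of `C` with a witness for `N` is never barred from `N` once all smaller
    -- non-elements of `C` have been enumerated. It is at least `N` by `hle`, so the domain meets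
    -- `C` unboundedly.
    have hne : ∃ n, n ∈ C ∧ ∃ x, V n N x := by
      obtain ⟨n, hn, -, h⟩ := hC.exists_mem_ge (hex N) 0
      exact ⟨n, hn, h⟩
    obtain ⟨hnC, x, hx⟩ := Nat.find_spec hne
    have hmin : ∀ m < Nat.find hne, m ∈ C → ∀ x, ¬ V m N x := fun m hm hmC x hx =>
      Nat.find_min hne hm ⟨hmC, x, hx⟩
    generalize Nat.find hne = n at *
    refine ⟨n, hnC, hle _ _ _ hx, ?_⟩
    obtain ⟨s₀, hs₀⟩ := (hRV (n, N, x)).1 hx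
    have hstage : ∃ s₁, ∀ m < n, m ∉ C → M m s₁ := by
      have : ∀ m, ∃ s, m ∉ C → M m s := fun m => by
        by_cases hm : m ∈ C
        · exact ⟨0, fun h => (h hm).elim⟩
        · obtain ⟨s, hs⟩ := (hMC m).1 hm
          exact ⟨s, fun _ => hs⟩
      choose s hs using this
      exact ⟨(Finset.range n).sup s, fun m hm hmC =>
        hMmono _ _ _ (Finset.le_sup (Finset.mem_range.2 hm)) (hs m hmC)⟩
    obtain ⟨s₁, hs₁⟩ := hstage
    refine hdom n (max n (max s₀ s₁)) N x ⟨⟨le_max_left _ _, hRmono _ _ _ (by simp) hs₀⟩, ?_⟩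
    intro m hm
    by_cases hmC : m ∈ C
    · exact Or.inr fun x' _ h => hmin m hm hmC x' (hRV' _ _ _ _ h)
    · exact Or.inl (hMmono _ _ _ (by simp) (hs₁ m hm hmC))
  -- Every value of the parameter is used by only finitely many elements of `C`.
  have hfin : ∀ k, ∃ N, ∀ n ∈ C, N ≤ n → ∀ s x, ¬ cond n (s, k, x) := by
    intro k
    by_cases hk : ∃ m ∈ C, ∃ x, V m k x
    · obtain ⟨m, hmC, x₀, hx₀⟩ := hk
      obtain ⟨s₀, hs₀⟩ := (hRV (m, k, x₀)).1 hx₀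
      -- Beyond this bound every admissible stage exceeds `m`, `s₀` and `x₀`, so the witness at `m`
      -- is visible; as `m ∈ C` is never enumerated outside `C`, it bars `k`.
      refine ⟨m + s₀ + x₀ + 1, fun n hn hNn s x h => ?_⟩
      obtain ⟨⟨hns, -⟩, h⟩ := h
      dsimp only at hns h
      rcases h m (by omega) with h | h
      · exact (hMC m).2 ⟨s, h⟩ hmC
      · exact h x₀ (by omega) (hRmono _ _ _ (by omega) hs₀)
    · push Not at hk
      exact ⟨0, fun n hn _ s x h => hk n hn x (hRV' _ _ _ _ h.1.2)⟩
  refine ⟨θ, hθ, fun n x hx => ?_, fun k => ?_⟩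
  · obtain ⟨s, k, h⟩ := hθcond n x hx
    exact hanti _ _ _ _ (Nat.zero_le k) (hRV' _ _ _ _ h.1.2)
  · choose N hN using hfin
    -- Past all the bounds for parameters below `k`, the search can only return a parameter `j ≥ k`,
    -- and `hanti` lowers it to `k`.
    have h' : AlmostSubset C {n | (Finset.range k).sup N ≤ n} := AlmostSubset.of_bound _ fun _ _ h => h
    obtain ⟨B, hB⟩ := (hadom.inter h').exists_bound
    refine AlmostSubset.of_bound B fun n hn hBn => ?_
    obtain ⟨hnd, hnN⟩ := hB n hn hBn
    obtain ⟨x, hx⟩ := Part.dom_iff_mem.1 hnd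
    obtain ⟨s, j, h⟩ := hθcond n x hx
    refine ⟨x, hx, hanti n k j x ?_ (hRV' _ _ _ _ h.1.2)⟩
    by_contra hjk
    exact hN j n hn ((Finset.le_sup (Finset.mem_range.2 (not_le.1 hjk))).trans hnN) s x h

/-! ### Closure of c.e. predicates, and medians -/

theorem REPred.and {α : Type*} [Primcodable α] {p q : α → Prop} (hp : REPred p) (hq : REPred q) :
    REPred fun a => p a ∧ q a :=
  (Partrec.dom_re (Partrec.bind hp ((Partrec.comp hq Computable.fst).to₂ :
    Partrec₂ fun (a : α) (_ : Unit) => Part.assert (q a) fun _ => Part.some ()))).of_eq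
      fun a => by simp [Part.dom_iff_mem]

theorem REPred.comp {α β : Type*} [Primcodable α] [Primcodable β] {p : β → Prop} {f : α → β}
    (hp : REPred p) (hf : Computable f) : REPred fun a => p (f a) :=
  Partrec.comp hp hf

theorem REPred.exists_mem {α β : Type*} [Primcodable α] [Primcodable β] {p : α × β → Prop}
    {f : α →. β} (hf : Partrec f) (hp : REPred p) : REPred fun a => ∃ b ∈ f a, p (a, b) :=
  (Partrec.dom_re (hf.bind (g := fun a b => Part.assert (p (a, b)) fun _ => Part.some ())
    hp)).of_eq fun a => by simp [Part.dom_iff_mem]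

theorem Finset.exists_median {α : Type*} [LinearOrder α] (s : Finset α) (k : ℕ)
    (hs : 2 * k + 1 ≤ s.card) :
    ∃ x ∈ s, k ≤ {y ∈ s | y < x}.card ∧ k ≤ {y ∈ s | x < y}.card := by
  let f := s.orderEmbOfFin rfl
  let i : Fin s.card := ⟨k, by omega⟩
  refine ⟨f i, s.orderEmbOfFin_mem rfl i, ?_, ?_⟩
  · have h : (Finset.Iio i).map f.toEmbedding ⊆ {y ∈ s | y < f i} := by
      intro y hy
      obtain ⟨j, hj, rfl⟩ := Finset.mem_map.1 hy
      exact Finset.mem_filter.2 ⟨s.orderEmbOfFin_mem rfl j, f.strictMono (Finset.mem_Iio.1 hj)⟩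
    have := Finset.card_le_card h
    rw [Finset.card_map, Fin.card_Iio] at this
    exact this
  · have h : (Finset.Ioi i).map f.toEmbedding ⊆ {y ∈ s | f i < y} := by
      intro y hy
      obtain ⟨j, hj, rfl⟩ := Finset.mem_map.1 hy
      exact Finset.mem_filter.2 ⟨s.orderEmbOfFin_mem rfl j, f.strictMono (Finset.mem_Ioi.1 hj)⟩
    have := Finset.card_le_card h
    rw [Finset.card_map, Fin.card_Ioi] at this
    exact (show k ≤ s.card - 1 - k by omega).trans this

/-! ### Counting elements between two points of `L` -/

namespace ComputableLinearOrder

variable {L : ComputableLinearOrder}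

variable (L) in
/-- There are at least `k` elements of `L` strictly between `a` and `b`. -/
def Far (k a b : ℕ) : Prop := ∃ F : Finset ℕ, k ≤ F.card ∧ ∀ y ∈ F, L.Rel a y ∧ L.Rel y b

theorem Far.anti {k l a b : ℕ} (h : L.Far l a b) (hkl : k ≤ l) : L.Far k a b :=
  let ⟨F, hF, hFab⟩ := h
  ⟨F, hkl.trans hF, hFab⟩

/-- The index must be positive: `Far 0` holds of any two numbers, even outside the domain. -/
theorem Far.rel {k a b : ℕ} (h : L.Far (k + 1) a b) : L.Rel a b := by
  obtain ⟨F, hF, hFab⟩ := h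
  obtain ⟨y, hy⟩ := Finset.card_pos.1 (show 0 < F.card by omega)
  exact L.trans _ _ _ (hFab y hy).1 (hFab y hy).2

theorem far_one {a x b : ℕ} (h : L.Rel a x) (h' : L.Rel x b) : L.Far 1 a b :=
  ⟨{x}, by simp, by simp [h, h']⟩

/-- The intermediate point itself is the additional element. -/
theorem Far.trans_rel {k a x b : ℕ} (h : L.Far (k + 1) a x) (h' : L.Rel x b) :
    L.Far (k + 2) a b := by
  have hax := h.rel
  obtain ⟨F, hF, hFab⟩ := h
  have hx : x ∉ F := fun hx => L.irrefl x (hFab x hx).2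
  refine ⟨insert x F, by rw [Finset.card_insert_of_notMem hx]; omega, fun y hy => ?_⟩
  rcases Finset.mem_insert.1 hy with rfl | hy
  · exact ⟨hax, h'⟩
  · exact ⟨(hFab y hy).1, L.trans _ _ _ (hFab y hy).2 h'⟩

theorem Far.rel_trans {k a x b : ℕ} (h' : L.Rel a x) (h : L.Far (k + 1) x b) :
    L.Far (k + 2) a b := by
  have hxb := h.rel
  obtain ⟨F, hF, hFab⟩ := h
  have hx : x ∉ F := fun hx => L.irrefl x (hFab x hx).1
  refine ⟨insert x F, by rw [Finset.card_insert_of_notMem hx]; omega, fun y hy => ?_⟩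
  rcases Finset.mem_insert.1 hy with rfl | hy
  · exact ⟨h', hxb⟩
  · exact ⟨L.trans _ _ _ h' (hFab y hy).1, (hFab y hy).2⟩

theorem Far.exists_median {k a b : ℕ} (h : L.Far (2 * k + 1) a b) :
    ∃ x, L.Far k a x ∧ L.Far k x b := by
  obtain ⟨F, hF, hFab⟩ := h
  -- The median must be taken in the order of `L`, so the finite set is pulled back from `ℕ` to
  -- `L.Elem`.
  let v : L.Elem ↪ ℕ := ⟨fun y => y.1, Subtype.val_injective⟩
  let G : Finset L.Elem := F.preimage v v.injective.injOn
  have hG : G.map v = F := by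
    ext y
    simp only [Finset.mem_map, G, Finset.mem_preimage]
    constructor
    · rintro ⟨z, hz, rfl⟩
      exact hz
    · exact fun hy => ⟨⟨y, (L.mem_of_rel _ _ (hFab y hy).1).2⟩, hy, rfl⟩
  have hmem : ∀ y ∈ G, L.Rel a y.1 ∧ L.Rel y.1 b := fun y hy => hFab y.1 (Finset.mem_preimage.1 hy)
  obtain ⟨x, hx, h₁, h₂⟩ := G.exists_median k (by rw [← Finset.card_map v, hG]; exact hF)
  refine ⟨x.1, ⟨_, (Finset.card_map v).symm ▸ h₁, ?_⟩, ⟨_, (Finset.card_map v).symm ▸ h₂, ?_⟩⟩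
  · intro y hy
    obtain ⟨z, hz, rfl⟩ := Finset.mem_map.1 hy
    obtain ⟨hz, hzx⟩ := Finset.mem_filter.1 hz
    exact ⟨(hmem z hz).1, hzx⟩
  · intro y hy
    obtain ⟨z, hz, rfl⟩ := Finset.mem_map.1 hy
    obtain ⟨hz, hzx⟩ := Finset.mem_filter.1 hz
    exact ⟨hzx, (hmem z hz).2⟩

/-- Counting the intermediate elements below a bound `s` is computable, so one searches for an `s`
that makes the count large enough. -/
theorem re_far (L : ComputableLinearOrder) :
    REPred fun p : ℕ × ℕ × ℕ => L.Far p.1 p.2.1 p.2.2 := by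
  classical
  let count : (ℕ × ℕ) × ℕ → ℕ := fun q => Nat.count (fun y => L.Rel q.1.1 y ∧ L.Rel y q.1.2) q.2
  have hcount : Computable count := by
    have hrel : Computable fun p : ℕ × ℕ => decide (L.Rel p.1 p.2) := L.computable_rel.decide
    have h : Computable₂ fun (q : (ℕ × ℕ) × ℕ) (z : ℕ × ℕ) =>
        if L.Rel q.1.1 z.1 ∧ L.Rel z.1 q.1.2 then z.2 + 1 else z.2 := by
      have h₁ := hrel.comp (g := fun r : ((ℕ × ℕ) × ℕ) × ℕ × ℕ => (r.1.1.1, r.2.1))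
        ((Computable.fst.comp (Computable.fst.comp .fst)).pair (Computable.fst.comp .snd))
      have h₂ := hrel.comp (g := fun r : ((ℕ × ℕ) × ℕ) × ℕ × ℕ => (r.2.1, r.1.1.2))
        ((Computable.fst.comp .snd).pair (Computable.snd.comp (Computable.fst.comp .fst)))
      have hz : Computable fun r : ((ℕ × ℕ) × ℕ) × ℕ × ℕ => r.2.2 := Computable.snd.comp .snd
      refine ((Primrec.and.to_comp.comp h₁ h₂).cond (Computable.succ.comp hz) hz).of_eq fun r => ?_
      simp only [← Bool.decide_and, Bool.cond_decide]
    refine (Computable.nat_rec Computable.snd (Computable.const 0) h).of_eq fun q => ?_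
    simp only [count]
    induction q.2 with
    | zero => simp
    | succ s ih =>
      dsimp only at ih ⊢
      rw [ih, Nat.count_succ]
      split_ifs <;> simp
  have hsearch : Partrec fun p : ℕ × ℕ × ℕ =>
      Nat.rfind fun s => Part.some (decide (p.1 ≤ count (p.2, s))) := by
    refine Partrec.rfind (p := fun (p : ℕ × ℕ × ℕ) s => Part.some (decide (p.1 ≤ count (p.2, s)))) ?_
    have : Computable fun r : (ℕ × ℕ × ℕ) × ℕ => decide (r.1.1 ≤ count (r.1.2, r.2)) :=
      Primrec.nat_le.decide.to_comp.comp (Computable.fst.comp .fst)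
        (hcount.comp ((Computable.snd.comp .fst).pair .snd))
    exact this.partrec
  refine (Partrec.dom_re hsearch).of_eq fun p => ?_
  refine Iff.trans Nat.rfind_dom' ?_
  constructor
  · rintro ⟨s, hs, -⟩
    have hs : p.1 ≤ count (p.2, s) := by simpa using hs
    simp only [count, Nat.count_eq_card_filter_range] at hs
    exact ⟨_, hs, fun y hy => (Finset.mem_filter.1 hy).2⟩
  · rintro ⟨F, hF, hFab⟩
    refine ⟨F.sup id + 1, ?_, fun _ => trivial⟩
    have : p.1 ≤ count (p.2, F.sup id + 1) := by
      simp only [count, Nat.count_eq_card_filter_range]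
      refine hF.trans (Finset.card_le_card fun y hy => Finset.mem_filter.2 ⟨?_, hFab y hy⟩)
      exact Finset.mem_range.2 (Nat.lt_succ_of_le (Finset.le_sup (f := id) hy))
    simpa using this

theorem IsCopyOfOmega.nonempty_orderIso (hL : L.IsCopyOfOmega) : Nonempty (L.Elem ≃o ℕ) := by
  rw [IsCopyOfOmega, ← OrderType.type_nat] at hL
  exact OrderType.type_eq_type.1 hL

theorem IsCopyOfOmega.exists_far (hL : L.IsCopyOfOmega) (k : ℕ) {a : ℕ} (ha : a ∈ L.carrier) :
    ∃ x, L.Far k a x := by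
  obtain ⟨e⟩ := hL.nonempty_orderIso
  let a' : L.Elem := ⟨a, ha⟩
  let v : ℕ ↪ ℕ := ⟨fun i => (e.symm i).1, Subtype.val_injective.comp e.symm.injective⟩
  refine ⟨(e.symm (e a' + k + 1)).1, (Finset.Ioo (e a') (e a' + k + 1)).map v, by simp; omega, ?_⟩
  intro y hy
  obtain ⟨i, hi, rfl⟩ := Finset.mem_map.1 hy
  rw [Finset.mem_Ioo] at hi
  refine ⟨?_, e.symm.strictMono hi.2⟩
  have : a' < e.symm i := by rw [← e.lt_iff_lt]; simpa using hi.1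
  exact this

theorem IsCopyOfOmega.exists_least (hL : L.IsCopyOfOmega) :
    ∃ a ∈ L.carrier, ∀ b, ¬ L.Rel b a := by
  obtain ⟨e⟩ := hL.nonempty_orderIso
  refine ⟨(e.symm 0).1, (e.symm 0).2, fun b hb => ?_⟩
  let b' : L.Elem := ⟨b, (L.mem_of_rel _ _ hb).1⟩
  have : b' < e.symm 0 := hb
  rw [← e.lt_iff_lt] at this
  simp at this

end ComputableLinearOrder

/-! ### Constructing elements of the cohesive power -/

namespace CohesiveRep

variable {L : ComputableLinearOrder} {C : Set ℕ}

/-- For almost all `n ∈ C` there are at least `k` elements of `L` between `φ(n)` and `ψ(n)`. -/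
def FarC (k : ℕ) (φ ψ : CohesiveRep L C) : Prop :=
  AlmostSubset C {n | ∃ a ∈ φ.fn n, ∃ b ∈ ψ.fn n, L.Far k a b}

theorem FarC.ltC {k : ℕ} {φ ψ : CohesiveRep L C} (h : FarC (k + 1) φ ψ) : LtC φ ψ :=
  AlmostSubset.mono h fun _ ⟨a, ha, b, hb, hab⟩ => ⟨a, ha, b, hb, hab.rel⟩

theorem farC_one {φ θ ψ : CohesiveRep L C} (h : LtC φ θ) (h' : LtC θ ψ) : FarC 1 φ ψ := by
  refine (AlmostSubset.inter h h').mono ?_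
  rintro n ⟨⟨a, ha, x, hx, hax⟩, y, hy, b, hb, hxb⟩
  obtain rfl := Part.mem_unique hx hy
  exact ⟨a, ha, b, hb, ComputableLinearOrder.far_one hax hxb⟩

theorem FarC.trans_ltC {k : ℕ} {φ θ ψ : CohesiveRep L C} (h : FarC (k + 1) φ θ) (h' : LtC θ ψ) :
    FarC (k + 2) φ ψ := by
  refine (AlmostSubset.inter h h').mono ?_
  rintro n ⟨⟨a, ha, x, hx, hax⟩, y, hy, b, hb, hxb⟩
  obtain rfl := Part.mem_unique hx hy
  exact ⟨a, ha, b, hb, hax.trans_rel hxb⟩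

theorem FarC.ltC_trans {k : ℕ} {φ θ ψ : CohesiveRep L C} (h : LtC φ θ) (h' : FarC (k + 1) θ ψ) :
    FarC (k + 2) φ ψ := by
  refine (AlmostSubset.inter h h').mono ?_
  rintro n ⟨⟨a, ha, x, hx, hax⟩, y, hy, b, hb, hxb⟩
  obtain rfl := Part.mem_unique hx hy
  exact ⟨a, ha, b, hb, .rel_trans hax hxb⟩

theorem exists_farC_between (hco : IsCoCE C) (hC : IsCohesive C) {φ ψ : CohesiveRep L C}
    (h : ∀ k, FarC (k + 1) φ ψ) :
    ∃ θ : CohesiveRep L C, (∀ k, FarC (k + 1) φ θ) ∧ ∀ k, FarC (k + 1) θ ψ := by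
  obtain ⟨θ, hθ, hθ₀, hθV⟩ := hC.exists_uniform_choice hco
    -- The clause `k ≤ n` is what uniformization demands of its parameter; it costs only finitely
    -- many `n` for each `k`.
    (V := fun n k x => k ≤ n ∧ ∃ a ∈ φ.fn n, ∃ b ∈ ψ.fn n, L.Far (k + 1) a x ∧ L.Far (k + 1) x b)
    (by
      refine REPred.and (Primrec.nat_le.comp (Primrec.fst.comp .snd) .fst).computablePred.to_re ?_
      refine REPred.exists_mem (f := fun p : ℕ × ℕ × ℕ => φ.fn p.1)
        (p := fun q : (ℕ × ℕ × ℕ) × ℕ => ∃ b ∈ ψ.fn q.1.1,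
          L.Far (q.1.2.1 + 1) q.2 q.1.2.2 ∧ L.Far (q.1.2.1 + 1) q.1.2.2 b)
        (φ.partrec.comp Computable.fst) ?_
      refine REPred.exists_mem (f := fun q : (ℕ × ℕ × ℕ) × ℕ => ψ.fn q.1.1)
        (p := fun r : ((ℕ × ℕ × ℕ) × ℕ) × ℕ =>
          L.Far (r.1.1.2.1 + 1) r.1.2 r.1.1.2.2 ∧ L.Far (r.1.1.2.1 + 1) r.1.1.2.2 r.2)
        (ψ.partrec.comp (Computable.fst.comp .fst)) ?_
      have hp : Computable fun r : ((ℕ × ℕ × ℕ) × ℕ) × ℕ => r.1.1.2 :=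
        Computable.snd.comp (Computable.fst.comp .fst)
      have hk := Computable.succ.comp (Computable.fst.comp hp)
      have hx := Computable.snd.comp hp
      exact (L.re_far.comp (hk.pair ((Computable.snd.comp .fst).pair hx))).and
        (L.re_far.comp (hk.pair (hx.pair .snd))))
    (fun n k x h => h.1)
    (fun n k l x hkl ⟨hln, a, ha, b, hb, h₁, h₂⟩ =>
      ⟨hkl.trans hln, a, ha, b, hb, h₁.anti (by omega), h₂.anti (by omega)⟩)
    (fun k => by
      -- A gap of `2 * (k + 1) + 1` elements has a median with `k + 1` on each side.
      refine (AlmostSubset.inter (h (2 * (k + 1)))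
        (AlmostSubset.of_bound (Y := {n | k ≤ n}) k fun _ _ h => h)).mono ?_
      rintro n ⟨⟨a, ha, b, hb, hab⟩, hkn⟩
      obtain ⟨x, h₁, h₂⟩ := hab.exists_median
      exact ⟨x, hkn, a, ha, b, hb, h₁, h₂⟩)
  refine ⟨⟨θ, hθ, fun n x hx => ?_, (hθV 0).mono ?_⟩, fun k => (hθV k).mono ?_,
    fun k => (hθV k).mono ?_⟩
  · obtain ⟨-, a, -, b, -, hax, -⟩ := hθ₀ n x hx
    exact (L.mem_of_rel _ _ hax.rel).2
  · rintro n ⟨x, hx, -⟩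
    exact Part.dom_iff_mem.2 ⟨x, hx⟩
  · rintro n ⟨x, hx, -, a, ha, b, hb, hax, -⟩
    exact ⟨a, ha, x, hx, hax⟩
  · rintro n ⟨x, hx, -, a, ha, b, hb, -, hxb⟩
    exact ⟨x, hx, b, hb, hxb⟩

theorem exists_farC_above (hL : L.IsCopyOfOmega) (hco : IsCoCE C) (hC : IsCohesive C)
    (φ : CohesiveRep L C) : ∃ θ : CohesiveRep L C, ∀ k, FarC (k + 1) φ θ := by
  obtain ⟨θ, hθ, hθ₀, hθV⟩ := hC.exists_uniform_choice hco
    (V := fun n k x => k ≤ n ∧ ∃ a ∈ φ.fn n, L.Far (k + 1) a x)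
    (by
      refine REPred.and (Primrec.nat_le.comp (Primrec.fst.comp .snd) .fst).computablePred.to_re ?_
      refine REPred.exists_mem (f := fun p : ℕ × ℕ × ℕ => φ.fn p.1)
        (p := fun q : (ℕ × ℕ × ℕ) × ℕ => L.Far (q.1.2.1 + 1) q.2 q.1.2.2)
        (φ.partrec.comp Computable.fst) ?_
      have hp : Computable fun r : (ℕ × ℕ × ℕ) × ℕ => r.1.2 := Computable.snd.comp .fst
      exact L.re_far.comp ((Computable.succ.comp (Computable.fst.comp hp)).pair
        (Computable.snd.pair (Computable.snd.comp hp))))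
    (fun n k x h => h.1)
    (fun n k l x hkl ⟨hln, a, ha, h⟩ => ⟨hkl.trans hln, a, ha, h.anti (by omega)⟩)
    (fun k => by
      refine (AlmostSubset.inter φ.almost_dom
        (AlmostSubset.of_bound (Y := {n | k ≤ n}) k fun _ _ h => h)).mono ?_
      rintro n ⟨hn, hkn⟩
      obtain ⟨a, ha⟩ := Part.dom_iff_mem.1 hn
      obtain ⟨x, hx⟩ := hL.exists_far (k + 1) (φ.mem_carrier n a ha)
      exact ⟨x, hkn, a, ha, hx⟩)
  refine ⟨⟨θ, hθ, fun n x hx => ?_, (hθV 0).mono ?_⟩, fun k => (hθV k).mono ?_⟩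
  · obtain ⟨-, a, -, hax⟩ := hθ₀ n x hx
    exact (L.mem_of_rel _ _ hax.rel).2
  · rintro n ⟨x, hx, -⟩
    exact Part.dom_iff_mem.2 ⟨x, hx⟩
  · rintro n ⟨x, hx, -, a, ha, hax⟩
    exact ⟨a, ha, x, hx, hax⟩

theorem exists_forall_not_ltC (hL : L.IsCopyOfOmega) (hC : IsCohesive C) :
    ∃ φ : CohesiveRep L C, ∀ ψ : CohesiveRep L C, ¬ LtC ψ φ := by
  obtain ⟨a, ha, hmin⟩ := hL.exists_least
  refine ⟨⟨fun _ => Part.some a, Computable.const a, fun n b hb => ?_,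
    AlmostSubset.of_bound 0 fun _ _ _ => trivial⟩, fun ψ h => ?_⟩
  · rwa [Part.mem_some_iff.1 hb]
  · obtain ⟨n, -, -, b, -, c, hc, hbc⟩ := hC.exists_mem_ge h 0
    rw [Part.mem_some_iff.1 hc] at hbc
    exact hmin b hbc

/-- A representative is determined by any code of its function; Cantor's theorem needs the resulting
countability. -/
instance : Countable (CohesiveRep L C) := by
  have h : ∀ φ : CohesiveRep L C, ∃ c : Nat.Partrec.Code, c.eval = φ.fn := fun φ =>
    Nat.Partrec.Code.exists_code.1 (Partrec.nat_iff.1 φ.partrec)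
  choose c hc using h
  refine Function.Injective.countable (f := c) fun φ ψ h => ?_
  have : φ.fn = ψ.fn := by rw [← hc, ← hc, h]
  cases φ; cases ψ; cases this; rfl

end CohesiveRep

/-! ### Infinite intervals of the cohesive power -/

namespace CohesivePower

variable {L : ComputableLinearOrder} {C : Set ℕ} {hC : IsCohesive C}

variable (hC) in
/-- The element of the cohesive power represented by `φ`. -/
def mk (φ : CohesiveRep L C) : CohesivePower L hC := Quotient.mk (CohesiveRep.setoid L C) φ

theorem mk_lt_mk {φ ψ : CohesiveRep L C} : mk hC φ < mk hC ψ ↔ φ.LtC ψ := Iff.rfl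

theorem mk_surjective : Function.Surjective (mk hC : CohesiveRep L C → CohesivePower L hC) :=
  Quotient.mk_surjective

instance : Countable (CohesivePower L hC) := mk_surjective.countable

/-- An interior point cuts an infinite interval into two, one of them infinite; induction applies to
that half, and the cut point adds one element. -/
theorem farC_of_infinite_Icc (k : ℕ) {φ ψ : CohesiveRep L C}
    (h : (Set.Icc (mk hC φ) (mk hC ψ)).Infinite) : φ.FarC (k + 1) ψ := by
  induction k generalizing φ ψ with
  | zero =>
    obtain ⟨z, ⟨h₁, h₂⟩, hz⟩ := (h.sdiff (Set.toFinite {mk hC φ, mk hC ψ})).nonempty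
    obtain ⟨θ, rfl⟩ := mk_surjective z
    simp only [Set.mem_insert_iff, Set.mem_singleton_iff, not_or] at hz
    exact CohesiveRep.farC_one (mk_lt_mk.1 (lt_of_le_of_ne h₁ (Ne.symm hz.1)))
      (mk_lt_mk.1 (lt_of_le_of_ne h₂ hz.2))
  | succ k ih =>
    obtain ⟨z, ⟨h₁, h₂⟩, hz⟩ := (h.sdiff (Set.toFinite {mk hC φ, mk hC ψ})).nonempty
    obtain ⟨θ, rfl⟩ := mk_surjective z
    simp only [Set.mem_insert_iff, Set.mem_singleton_iff, not_or] at hz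
    have hφθ := mk_lt_mk.1 (lt_of_le_of_ne h₁ (Ne.symm hz.1))
    have hθψ := mk_lt_mk.1 (lt_of_le_of_ne h₂ hz.2)
    rw [← Set.Icc_union_Icc_eq_Icc h₁ h₂, Set.infinite_union] at h
    rcases h with h | h
    · exact (ih h).trans_ltC hθψ
    · exact .ltC_trans hφθ (ih h)

theorem infinite_Icc_iff (hco : IsCoCE C) {φ ψ : CohesiveRep L C} :
    (Set.Icc (mk hC φ) (mk hC ψ)).Infinite ↔ ∀ k, φ.FarC (k + 1) ψ := by
  refine ⟨fun h k => farC_of_infinite_Icc k h, fun h hfin => ?_⟩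
  -- Descent: if the interval were finite, a point far from both ends would give a strictly smaller
  -- finite interval with the same hypothesis.
  generalize hN : (Set.Icc (mk hC φ) (mk hC ψ)).ncard = N
  induction N using Nat.strong_induction_on generalizing φ ψ with
  | _ N ih =>
    obtain ⟨θ, h₁, h₂⟩ := CohesiveRep.exists_farC_between hco hC h
    have hφθ : mk hC φ < mk hC θ := mk_lt_mk.2 (h₁ 0).ltC
    have hθψ : mk hC θ < mk hC ψ := mk_lt_mk.2 (h₂ 0).ltC
    have hsub : Set.Icc (mk hC φ) (mk hC θ) ⊂ Set.Icc (mk hC φ) (mk hC ψ) := by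
      refine ⟨Set.Icc_subset_Icc_right hθψ.le, fun h => ?_⟩
      exact hθψ.not_ge (h ⟨(hφθ.trans hθψ).le, le_rfl⟩).2
    exact ih _ (hN ▸ Set.ncard_lt_ncard hsub hfin) h₁ (hfin.subset hsub.subset) rfl

end CohesivePower

/-! ### The order of the blocks and its type -/

namespace FiniteCondensation

variable {α : Type*} [LinearOrder α]

theorem mk_surjective : Function.Surjective (mk : α → FiniteCondensation α) :=
  Quotient.mk_surjective

instance [Countable α] : Countable (FiniteCondensation α) := mk_surjective.countable

theorem mk_lt_mk_iff {x y : α} : mk x < mk y ↔ x < y ∧ (Set.Icc x y).Infinite := by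
  constructor
  · intro h
    have h' : Lt (mk x) (mk y) := h
    have hxy : x < y := h' x y rfl rfl
    refine ⟨hxy, fun hfin => h.ne (mk_eq_mk.2 ?_)⟩
    simpa [finiteBlock, min_eq_left hxy.le, max_eq_right hxy.le] using hfin
  · rintro ⟨hxy, hinf⟩
    refine lt_of_lt hxy fun h => hinf ?_
    simpa [finiteBlock, min_eq_left hxy.le, max_eq_right hxy.le] using h

end FiniteCondensation

/-- Above the least element lies a countable dense order without endpoints, which is `ℚ` by Cantor's
theorem. -/
theorem OrderType.type_eq_one_add_eta {α : Type} [LinearOrder α] [Countable α] [DenselyOrdered α]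
    [NoMaxOrder α] (b : α) (hb : ∀ x, b ≤ x) :
    OrderType.type α = OrderType.type Unit + OrderType.eta := by
  have : Unique (Set.Iic b) := ⟨⟨⟨b, le_rfl⟩⟩, fun x => Subtype.ext (le_antisymm x.2 (hb x.1))⟩
  have e₁ : Set.Iic b ≃o Unit := OrderIso.ofUnique _ _
  obtain ⟨e₂⟩ := Order.iso_of_countable_dense (Set.Ioi b) ℚ
  rw [OrderType.eta, ← OrderType.type_lex_sum]
  exact OrderType.type_congr ((OrderIso.sumLexIicIoi b).symm.trans (OrderIso.sumLexCongr e₁ e₂))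

theorem mainTheorem3 (L : ComputableLinearOrder) (hL : L.IsCopyOfOmega)
    (C : Set ℕ) (hco : IsCoCE C) (hC : IsCohesive C) :
    OrderType.type (FiniteCondensation (CohesivePower L hC)) =
      OrderType.type Unit + OrderType.eta := by
  have hlt : ∀ φ ψ : CohesiveRep L C, (∀ k, φ.FarC (k + 1) ψ) →
      FiniteCondensation.mk (CohesivePower.mk hC φ) <
        FiniteCondensation.mk (CohesivePower.mk hC ψ) := fun φ ψ h =>
    FiniteCondensation.mk_lt_mk_iff.2
      ⟨CohesivePower.mk_lt_mk.2 (h 0).ltC, (CohesivePower.infinite_Icc_iff hco).2 h⟩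
  have hsurj : ∀ I : FiniteCondensation (CohesivePower L hC), ∃ φ : CohesiveRep L C,
      FiniteCondensation.mk (CohesivePower.mk hC φ) = I :=
    FiniteCondensation.mk_surjective.comp CohesivePower.mk_surjective
  have : DenselyOrdered (FiniteCondensation (CohesivePower L hC)) := by
    refine ⟨fun I J hIJ => ?_⟩
    obtain ⟨φ, rfl⟩ := hsurj I
    obtain ⟨ψ, rfl⟩ := hsurj J
    obtain ⟨θ, h₁, h₂⟩ := CohesiveRep.exists_farC_between hco hC
      ((CohesivePower.infinite_Icc_iff hco).1 (FiniteCondensation.mk_lt_mk_iff.1 hIJ).2)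
    exact ⟨_, hlt φ θ h₁, hlt θ ψ h₂⟩
  have : NoMaxOrder (FiniteCondensation (CohesivePower L hC)) := by
    refine ⟨fun I => ?_⟩
    obtain ⟨φ, rfl⟩ := hsurj I
    obtain ⟨θ, h⟩ := φ.exists_farC_above hL hco hC
    exact ⟨_, hlt φ θ h⟩
  obtain ⟨φ, hφ⟩ := CohesiveRep.exists_forall_not_ltC hL hC
  refine OrderType.type_eq_one_add_eta (FiniteCondensation.mk (CohesivePower.mk hC φ)) fun J => ?_
  obtain ⟨ψ, rfl⟩ := hsurj J
  exact not_lt.1 fun h => hφ ψ (CohesivePower.mk_lt_mk.1 (FiniteCondensation.mk_lt_mk_iff.1 h).1)
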